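/- **Theorem (Deterministic Homomorphic Policy Gradient).** Let $S$ be a second countable topological space with its Borel $\sigma$-algebra and a $\sigma$-finite reference measure $ds$, let $\overline S$ be a compact second countable topological space with its Borel $\sigma$-algebra and a finite reference measure $d\overline s$ (for example a compact subset of $\mathbb R^m$ with Lebesgue measure), and let $A\subseteq\mathbb R^n$, $\overline A\subseteq\mathbb R^{\overline n}$ be open. Let $\mathcal M=(S,A,\tau,R,\gamma)$ and $\overline{\mathcal M}=(\overline S,\overline A,\overline\tau,\overline R,\gamma)$ be continuous Markov decision processes with discount factor $0<\gamma<1$: for each action $a$, $\tau_a(\cdot\mid s)$ is a Markov kernel, $R$ is a real-valued reward function, and $a\mapsto\tau_a(B\mid s)$ is $C^\infty$ for every state $s$ and measurable $B$; likewise for $\overline{\mathcal M}$. Let $h=(f,g_s)$ be a continuous MDP homomorphism from $\mathcal M$ to $\overline{\mathcal M}$: $f:S\to\overline S$ and all $g_s:A\to\overline A$ are measurable and surjective, $\overline R(f(s),g_s(a))=R(s,a)$, and $\overline\tau_{g_s(a)}(\overline B\mid f(s))=\tau_a(f^{-1}(\overline B)\mid s)$ for all $s,a$ and measurable $\overline B\subseteq\overline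 S$. Let $p_1$ be an initial state density on $S$ and $\overline p_1$ one on $\overline S$, such that $\overline p_1(\overline s)\,d\overline s$ is the image of $p_1(s)\,ds$ under $f$. Let $\overline\pi_\theta:\overline S\to\overline A$ $(\theta\in\mathbb R^k)$ be a parametrised deterministic policy on $\overline{\mathcal M}$, and let $\pi^\uparrow_\theta:S\to A$ be a lift of it, that is, $g_s(\pi^\uparrow_\theta(s))=\overline\pi_\theta(f(s))$ for all $s$ and $\theta$. Assume the following regularity conditions. 1. The kernels $\tau_a(\cdot\mid s)$ and $\overline\tau_{\overline a}(\cdot\mid\overline s)$ have densities $\tau_a(s'\mid s)$ and $\overline\tau_{\overline a}(\overline s'\mid\overline s)$ with respect to $ds'$ and $d\overline s'$. These densities and the rewards $R(s,a)$, $\overline R(\overline s,\overline a)$ are differentiable in the action, the policies $\pi^\uparrow_\theta(s)$, $\overline\pi_\theta(\overline s)$ are differentiable in $\theta$, and all these functions, their gradients $\nabla_a$, $\nabla_{\overline a}$, $\nabla_\theta$, and $p_1$, $\overline p_1$ are continuous jointly in all their variables. 2. There are constants $b,L$ such that $p_1$, $\overline p_1$, $\tau_a(s'\mid s)$, $\overline\tau_{\overline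 a}(\overline s'\mid\overline s)$, $R$, $\overline R$ are everywhere $<b$, and $\|\nabla_a\tau_a(s'\mid s)\|$, $\|\nabla_{\overline a}\overline\tau_{\overline a}(\overline s'\mid\overline s)\|$, $\|\nabla_aR\|$, $\|\nabla_{\overline a}\overline R\|$ are everywhere $<L$. 3. Each $g_s$ is a ($C^\infty$) local diffeomorphism, $\nabla_ag_s(a)$ is continuous in $a$, and $\|\nabla_ag_s(a)\|<L$ for all $s,a$. For a deterministic policy $\pi$ of an MDP let $p(s\to ds',t,\pi)$ be the law of the state at time $t$ when starting in $s$ and following $\pi$, let $V^\pi(s)=\sum_{t\ge0}\gamma^t\int R(s',\pi(s'))\,p(s\to ds',t,\pi)$ be the expected discounted return, and let $Q^\pi(s,a)=R(s,a)+\gamma\int V^\pi(s')\,\tau_a(ds'\mid s)$. Let $$J(\theta)=\int_S p_1(s)\,V^{\pi^\uparrow_\theta}(s)\,ds$$ be the performance of the lifted policy on $\mathcal M$, and let $\rho^{\overline\pi_\theta}$ be the discounted state distribution of $\overline{\mathcal M}$ under $\overline\pi_\theta$, that is, $\rho^{\overline\pi_\theta}(d\overline s')=\int_{\overline S}\overline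 p_1(\overline s)\sum_{t\ge0}\gamma^t\,p(\overline s\to d\overline s',t,\overline\pi_\theta)\,d\overline s$ (not normalised; we write $\rho^{\overline\pi_\theta}(\overline s)\,d\overline s$ for this measure). Then, for every $\theta$, the function $\overline a\mapsto\overline Q^{\overline\pi_\theta}(\overline s,\overline a)$ is differentiable at $\overline\pi_\theta(\overline s)$ for every $\overline s$, the integrand below is integrable with respect to $\rho^{\overline\pi_\theta}$, $J$ is differentiable at $\theta$, and $$\nabla_\theta J(\theta)=\int_{\overline S}\rho^{\overline\pi_\theta}(\overline s)\;\nabla_{\overline a}\overline Q^{\overline\pi_\theta}(\overline s,\overline a)\Big|_{\overline a=\overline\pi_\theta(\overline s)}\;\nabla_\theta\overline\pi_\theta(\overline s)\;d\overline s .$$ -/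

import Mathlib

open MeasureTheory ProbabilityTheory
open scoped ContDiff Manifold

noncomputable section

/-- A continuous Markov decision process with state space `S` and with an open set `A` of a
normed space `E` as its action space. Only the values of `τ`, `R` at actions in `A` matter. -/
structure ContMDP (S E : Type*) [MeasurableSpace S] [NormedAddCommGroup E] [NormedSpace ℝ E] where
  /-- the action space -/
  A : Set E
  isOpen_A : IsOpen A
  /-- the transition kernels: `τ a s B` is the probability to move from `s` into `B` under `a` -/
  τ : E → Kernel S S
  isMarkovKernel : ∀ a ∈ A, IsMarkovKernel (τ a)
  /-- the reward function -/
  R : S → E → ℝ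
  /-- the discount factor -/
  γ : ℝ
  γ_pos : 0 < γ
  γ_lt_one : γ < 1
  smooth : ∀ (s : S) (B : Set S), MeasurableSet B → ContDiffOn ℝ ∞ (fun a => (τ a s).real B) A

namespace ContMDP

variable {S E : Type*} [MeasurableSpace S] [NormedAddCommGroup E] [NormedSpace ℝ E]

/-- The law of the state at time `t`, when the process starts at time `0` in `s` and the
deterministic policy `π` is followed. -/
def stepDist (M : ContMDP S E) (π : S → E) : ℕ → S → Measure S
  | 0, s => Measure.dirac s
  | t + 1, s => (stepDist M π t s).bind (fun s' => M.τ (π s') s')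

/-- The value function `V^π`: the expected return `∑ γ^t E[R(s_t, π(s_t))]` from `s_0 = s`. -/
def value (M : ContMDP S E) (π : S → E) (s : S) : ℝ :=
  ∑' t : ℕ, M.γ ^ t * ∫ s', M.R s' (π s') ∂(M.stepDist π t s)

/-- The action-value function `Q^π`: the expected return when the action `a` is taken in the
state `s` and the policy `π` is followed thereafter. -/
def actionValue (M : ContMDP S E) (π : S → E) (s : S) (a : E) : ℝ :=
  M.R s a + M.γ * ∫ s', M.value π s' ∂(M.τ a s)

/-- The performance measure `J = ∫ p₁(s) V^π(s) ds` of the policy `π`, for the initial state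
density `p₁` with respect to the reference measure `ν`. -/
def performance (M : ContMDP S E) (ν : Measure S) (p₁ : S → ℝ) (π : S → E) : ℝ :=
  ∫ s, p₁ s * M.value π s ∂ν

/-- The (unnormalised) discounted state distribution
`ρ^π(ds') = ∫ p₁(s) ∑ γ^t p(s → ds', t, π) ds`. -/
def discountedStateDist (M : ContMDP S E) (ν : Measure S) (p₁ : S → ℝ) (π : S → E) : Measure S :=
  Measure.sum fun t : ℕ =>
    ENNReal.ofReal (M.γ ^ t) •
      (ν.withDensity (fun s => ENNReal.ofReal (p₁ s))).bind (M.stepDist π t)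

/-- The regularity conditions on the data of one MDP: `q a s s'` is the density `τ_a(s' | s)` of
the transition kernel and `p₁` the density of the initial state, both with respect to the
reference measure `ν`. Densities, rewards and their gradients with respect to the action are
continuous in all variables, and bounded as required by the constants `b` and `L`. -/
structure IsRegular [TopologicalSpace S] (M : ContMDP S E) (ν : Measure S)
    (q : E → S → S → ℝ) (p₁ : S → ℝ) (b L : ℝ) : Prop where
  q_nonneg : ∀ a ∈ M.A, ∀ s s', 0 ≤ q a s s'
  τ_eq : ∀ a ∈ M.A, ∀ s, M.τ a s = ν.withDensity (fun s' => ENNReal.ofReal (q a s s'))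
  q_continuous : ContinuousOn (fun x : E × S × S => q x.1 x.2.1 x.2.2) (M.A ×ˢ Set.univ)
  q_differentiable : ∀ a ∈ M.A, ∀ s s', DifferentiableAt ℝ (fun x => q x s s') a
  q_gradient_continuous :
    ContinuousOn (fun x : E × S × S => fderiv ℝ (fun y => q y x.2.1 x.2.2) x.1)
      (M.A ×ˢ Set.univ)
  q_lt : ∀ a ∈ M.A, ∀ s s', q a s s' < b
  q_gradient_lt : ∀ a ∈ M.A, ∀ s s', ‖fderiv ℝ (fun x => q x s s') a‖ < L
  R_continuous : ContinuousOn (fun x : S × E => M.R x.1 x.2) (Set.univ ×ˢ M.A)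
  R_differentiable : ∀ s, ∀ a ∈ M.A, DifferentiableAt ℝ (M.R s) a
  R_gradient_continuous :
    ContinuousOn (fun x : S × E => fderiv ℝ (M.R x.1) x.2) (Set.univ ×ˢ M.A)
  R_lt : ∀ s, ∀ a ∈ M.A, M.R s a < b
  R_gradient_lt : ∀ s, ∀ a ∈ M.A, ‖fderiv ℝ (M.R s) a‖ < L
  p₁_nonneg : ∀ s, 0 ≤ p₁ s
  p₁_total : ∫⁻ s, ENNReal.ofReal (p₁ s) ∂ν = 1
  p₁_continuous : Continuous p₁
  p₁_lt : ∀ s, p₁ s < b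

/-- A parametrised deterministic policy `π θ : S → A`, differentiable in the parameter, such that
`π` and its derivative with respect to the parameter are continuous in all variables. -/
structure IsRegularPolicy [TopologicalSpace S] (M : ContMDP S E)
    {Θ : Type*} [NormedAddCommGroup Θ] [NormedSpace ℝ Θ] (π : Θ → S → E) : Prop where
  mem_A : ∀ θ s, π θ s ∈ M.A
  continuous : Continuous (fun x : Θ × S => π x.1 x.2)
  differentiable : ∀ s, Differentiable ℝ (fun θ => π θ s)
  gradient_continuous : Continuous (fun x : Θ × S => fderiv ℝ (fun θ => π θ x.2) x.1)

variable {S' E' : Type*} [MeasurableSpace S'] [NormedAddCommGroup E'] [NormedSpace ℝ E']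

/-- `(f, g)` is a continuous MDP homomorphism from `M` onto `M'`. -/
structure IsHom [MeasurableSpace E] [MeasurableSpace E'] (M : ContMDP S E) (M' : ContMDP S' E')
    (f : S → S') (g : S → E → E') : Prop where
  γ_eq : M'.γ = M.γ
  f_measurable : Measurable f
  f_surjective : Function.Surjective f
  g_mapsTo : ∀ s, Set.MapsTo (g s) M.A M'.A
  g_measurable : ∀ s, Measurable (M.A.domRestrict (g s))
  g_surjOn : ∀ s, Set.SurjOn (g s) M.A M'.A
  reward : ∀ s, ∀ a ∈ M.A, M'.R (f s) (g s a) = M.R s a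
  transition : ∀ s, ∀ a ∈ M.A, ∀ B' : Set S', MeasurableSet B' →
    M'.τ (g s a) (f s) B' = M.τ a s (f ⁻¹' B')

/-- The regularity conditions on the action maps `g s : M.A → M'.A`. -/
structure IsRegularActionMap (M : ContMDP S E) (g : S → E → E') (L : ℝ) : Prop where
  localDiffeo : ∀ s, IsLocalDiffeomorphOn 𝓘(ℝ, E) 𝓘(ℝ, E') ∞ (g s) M.A
  gradient_continuous : ∀ s, ContinuousOn (fderiv ℝ (g s)) M.A
  gradient_lt : ∀ s, ∀ a ∈ M.A, ‖fderiv ℝ (g s) a‖ < L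

/-- The deterministic policy `πl` on the domain of `(f, g)` is a lift of the deterministic policy
`π'`: the image of `πl(s)` under `g s` is `π'(f(s))`. -/
def IsLift (f : S → S') (g : S → E → E') (πl : S → E) (π' : S' → E') : Prop :=
  ∀ s, g s (πl s) = π' (f s)

end ContMDP

end

/-! The lift condition and the homomorphism carry the law of the state on `M` under the lifted
policy to the law on `M'` under `π'`. Hence the value functions agree along `f` (`IsHom.value_eq`),
and since `f` also carries one initial law to the other, `J` is the performance of `π'` on `M'`. It
remains to prove the deterministic policy gradient theorem on the compact space `S'`
(`IsRegular.policy_gradient`).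

There everything happens in the Banach space of continuous functions with the sup norm. The
transition operator `K_θ` has norm at most 1, so the value is `V_θ = (1 - γ K_θ)⁻¹ r_θ`. Compactness
turns joint continuity of the gradients into differentiability of `r_θ` in sup norm and of `K_θ` in
operator norm, and the resolvent formula gives `V' = (1 - γ K)⁻¹ (r' + γ K' V)`. The bracket at `s`
is the action gradient of `Q` at `π_θ(s)` composed with the derivative of `π_θ(s)` in `θ`.
Integrating the resolvent of a function against the initial law is the same as integrating the
function against `ρ` (`IsRegular.integral_discountedStateDist`). -/

open Filter Topology

/-! ### Differentiation of parametrised families in the sup norm. -/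

namespace ContinuousMap

variable {X Θ F : Type*} [TopologicalSpace X] [CompactSpace X]
  [NormedAddCommGroup Θ] [NormedSpace ℝ Θ] [NormedAddCommGroup F] [NormedSpace ℝ F]

/-- A continuous family of continuous linear maps, as a continuous linear map into the space of
continuous functions. -/
noncomputable def flipCLM (A : C(X, Θ →L[ℝ] F)) : Θ →L[ℝ] C(X, F) :=
  LinearMap.mkContinuous
    { toFun := fun h => ⟨fun x => A x h, by fun_prop⟩
      map_add' := fun h h' => by ext x; simp
      map_smul' := fun c h => by ext x; simp }
    ‖A‖ fun h => (ContinuousMap.norm_le _ (by positivity)).2 fun x =>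
      ((A x).le_opNorm h).trans (by gcongr; exact A.norm_coe_le_norm x)

@[simp]
theorem flipCLM_apply (A : C(X, Θ →L[ℝ] F)) (h : Θ) (x : X) : flipCLM A h x = A x h := rfl

/-- A family of functions on a compact space with a jointly continuous pointwise derivative in the
parameter is differentiable in the parameter for the uniform norm. -/
theorem hasFDerivAt_of_forall_hasFDerivAt (G : Θ → C(X, F)) (G' : C(Θ × X, Θ →L[ℝ] F))
    (hG : ∀ θ x, HasFDerivAt (fun ϑ => G ϑ x) (G' (θ, x)) θ) (θ : Θ) :
    HasFDerivAt G (flipCLM (G'.curry θ)) θ := by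
  rw [hasFDerivAt_iff_isLittleO, Asymptotics.isLittleO_iff]
  intro ε hε
  -- On a compact space the compact-open topology is that of the sup metric, so continuity of the
  -- curried derivative is uniform in `x`.
  have hc : ∀ᶠ ϑ in 𝓝 θ, dist (G'.curry ϑ) (G'.curry θ) < ε :=
    Metric.tendsto_nhds.1 (G'.curry.continuous.tendsto θ) ε hε
  obtain ⟨δ, hδ, hball⟩ := Metric.eventually_nhds_iff_ball.1 hc
  filter_upwards [Metric.ball_mem_nhds θ hδ] with ϑ hϑ
  refine (ContinuousMap.norm_le _ (by positivity)).2 fun x => ?_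
  -- Mean value inequality on a ball that does not depend on `x`.
  refine Convex.norm_image_sub_le_of_norm_hasFDerivWithin_le' (s := Metric.ball θ δ)
    (f := fun ϑ => G ϑ x) (f' := fun ϑ => G' (ϑ, x)) (φ := G' (θ, x))
    (fun y _ => (hG y x).hasFDerivWithinAt) (fun y hy => ?_) (convex_ball θ δ)
    (Metric.mem_ball_self hδ) hϑ
  rw [← dist_eq_norm]
  exact (ContinuousMap.dist_apply_le_dist x).trans (hball y hy).le

end ContinuousMap

/-! ### Integral operators with continuous kernels. -/

section KernelOperator

variable {X : Type*} [TopologicalSpace X] [SecondCountableTopology X] [CompactSpace X]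
  [MeasurableSpace X] [BorelSpace X]

theorem ContinuousMap.integrable_of_compactSpace {F : Type*} [NormedAddCommGroup F]
    (μ : Measure X) [IsFiniteMeasure μ] (φ : C(X, F)) : Integrable φ μ :=
  Integrable.of_bound φ.continuous.aestronglyMeasurable ‖φ‖
    (ae_of_all _ φ.norm_coe_le_norm)

/-- Integration against a finite measure, as a functional on continuous functions. -/
noncomputable def integralCLM (μ : Measure X) [IsFiniteMeasure μ] : C(X, ℝ) →L[ℝ] ℝ :=
  LinearMap.mkContinuous
    { toFun := fun φ => ∫ x, φ x ∂μ
      map_add' := fun φ ψ => integral_add (φ.integrable_of_compactSpace μ)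
        (ψ.integrable_of_compactSpace μ)
      map_smul' := fun c φ => integral_const_mul c _ }
    (μ.real Set.univ) fun φ => by
      rw [mul_comm]
      exact norm_integral_le_of_norm_le_const (ae_of_all _ φ.norm_coe_le_norm)

@[simp]
theorem integralCLM_apply (μ : Measure X) [IsFiniteMeasure μ] (φ : C(X, ℝ)) :
    integralCLM μ φ = ∫ x, φ x ∂μ := rfl

/-- The function `x ↦ ∫ k(x, y) φ(y) dν(y)` for a continuous kernel `k`. -/
noncomputable def kernelIntegral (ν : Measure X) [IsFiniteMeasure ν] (k : C(X × X, ℝ))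
    (φ : C(X, ℝ)) : C(X, ℝ) where
  toFun x := ∫ y, k (x, y) * φ y ∂ν
  continuous_toFun := by
    refine continuous_of_dominated (bound := fun _ => ‖k‖ * ‖φ‖)
      (fun x => Continuous.aestronglyMeasurable (by fun_prop))
      (fun x => ae_of_all _ fun y => ?_) (integrable_const _)
      (ae_of_all _ fun y => by fun_prop)
    rw [norm_mul]
    gcongr
    exacts [k.norm_coe_le_norm _, φ.norm_coe_le_norm _]

theorem integrable_kernel_mul (ν : Measure X) [IsFiniteMeasure ν] (k : C(X × X, ℝ))
    (φ : C(X, ℝ)) (x : X) : Integrable (fun y => k (x, y) * φ y) ν :=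
  ContinuousMap.integrable_of_compactSpace ν ⟨fun y => k (x, y) * φ y, by fun_prop⟩

/-- The integral operator with a continuous kernel, as a linear function of the kernel. -/
noncomputable def kernelOperator (ν : Measure X) [IsFiniteMeasure ν] :
    C(X × X, ℝ) →L[ℝ] C(X, ℝ) →L[ℝ] C(X, ℝ) :=
  LinearMap.mkContinuous₂
    (LinearMap.mk₂ ℝ (kernelIntegral ν)
      (fun k l φ => by
        ext x
        simp only [kernelIntegral, ContinuousMap.coe_mk, ContinuousMap.add_apply, add_mul]
        exact integral_add (integrable_kernel_mul ν k φ x) (integrable_kernel_mul ν l φ x))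
      (fun c k φ => by
        ext x
        simp only [kernelIntegral, ContinuousMap.coe_mk, ContinuousMap.smul_apply, smul_eq_mul,
          mul_assoc, integral_const_mul])
      (fun k φ ψ => by
        ext x
        simp only [kernelIntegral, ContinuousMap.coe_mk, ContinuousMap.add_apply, mul_add]
        exact integral_add (integrable_kernel_mul ν k φ x) (integrable_kernel_mul ν k ψ x))
      (fun c k φ => by
        ext x
        simp only [kernelIntegral, ContinuousMap.coe_mk, ContinuousMap.smul_apply, smul_eq_mul,
          mul_left_comm _ c, integral_const_mul]))
    (ν.real Set.univ) fun k φ => by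
      refine (ContinuousMap.norm_le _ (by positivity)).2 fun x => ?_
      rw [mul_assoc, mul_comm]
      refine norm_integral_le_of_norm_le_const (ae_of_all _ fun y => ?_)
      rw [norm_mul]
      gcongr
      exacts [k.norm_coe_le_norm _, φ.norm_coe_le_norm _]

@[simp]
theorem kernelOperator_apply (ν : Measure X) [IsFiniteMeasure ν] (k : C(X × X, ℝ))
    (φ : C(X, ℝ)) (x : X) : kernelOperator ν k φ x = ∫ y, k (x, y) * φ y ∂ν := rfl

end KernelOperator

/-! ### Resolvents of contractions and their derivatives. -/

section Resolvent

variable {F : Type*} [NormedAddCommGroup F] [NormedSpace ℝ F]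

theorem norm_smul_lt_one_of_norm_le_one {K : F →L[ℝ] F} (hK : ‖K‖ ≤ 1) {c : ℝ} (hc : 0 < c)
    (hc1 : c < 1) : ‖c • K‖ < 1 := by
  rw [norm_smul, Real.norm_of_nonneg hc.le]
  nlinarith

variable [CompleteSpace F]

/-- Ensures that `Ring.inverse` below is a genuine inverse and not its default value 0. -/
theorem isUnit_one_sub_smul {K : F →L[ℝ] F} (hK : ‖K‖ ≤ 1) {c : ℝ} (hc : 0 < c)
    (hc1 : c < 1) : IsUnit (1 - c • K) :=
  isUnit_one_sub_of_norm_lt_one (norm_smul_lt_one_of_norm_le_one hK hc hc1)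

/-- The Neumann series of the resolvent of a contraction. -/
theorem hasSum_inverse_one_sub_smul {K : F →L[ℝ] F} (hK : ‖K‖ ≤ 1) {c : ℝ} (hc : 0 < c)
    (hc1 : c < 1) (φ : F) :
    HasSum (fun t : ℕ => c ^ t • (K ^ t) φ) (Ring.inverse (1 - c • K) φ) := by
  have h := norm_smul_lt_one_of_norm_le_one hK hc hc1
  simpa [smul_pow] using (hasSum_geom_series_inverse _ h).mapL (ContinuousLinearMap.apply ℝ F φ)

/-- The derivative of the solution of `v = r + c K v`, for `r` and `K` depending on a parameter. -/
theorem hasFDerivAt_inverse_one_sub_smul_apply {Θ : Type*} [NormedAddCommGroup Θ]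
    [NormedSpace ℝ Θ] {K : Θ → F →L[ℝ] F} {K' : Θ →L[ℝ] F →L[ℝ] F} {r : Θ → F} {r' : Θ →L[ℝ] F}
    {c : ℝ} (hc : 0 < c) (hc1 : c < 1) {θ : Θ} (hKn : ∀ ϑ, ‖K ϑ‖ ≤ 1) (hK : HasFDerivAt K K' θ)
    (hr : HasFDerivAt r r' θ) :
    HasFDerivAt (fun ϑ => Ring.inverse (1 - c • K ϑ) (r ϑ))
      ((Ring.inverse (1 - c • K θ)).comp
        (r' + c • K'.flip (Ring.inverse (1 - c • K θ) (r θ)))) θ := by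
  obtain ⟨u, hu⟩ := isUnit_one_sub_smul (hKn θ) hc hc1
  have hA : HasFDerivAt (fun ϑ => 1 - c • K ϑ) (-(c • K')) θ := (hK.const_smul c).const_sub 1
  -- Inversion has derivative `T ↦ -u⁻¹ T u⁻¹` at `u`; its sign cancels the one in `1 - c • K`, and
  -- `u⁻¹` factors out on the left.
  have hinv := hasFDerivAt_ringInverse (𝕜 := ℝ) u
  rw [hu] at hinv
  refine ((hinv.comp θ hA).clm_apply hr).congr_fderiv ?_
  ext h
  rw [← hu, Ring.inverse_unit]
  simp

end Resolvent

theorem ProbabilityTheory.Kernel.integral_comp_measure {α β F : Type*} [MeasurableSpace α]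
    [MeasurableSpace β] [NormedAddCommGroup F] [NormedSpace ℝ F] {μ : Measure α} {κ : Kernel α β}
    {φ : β → F} (hφ : Integrable φ (μ.bind κ)) :
    ∫ y, φ y ∂(μ.bind κ) = ∫ x, ∫ y, φ y ∂κ x ∂μ := by
  -- The measure is regarded as a constant kernel on a one-point space.
  have h := Kernel.integral_comp (κ := Kernel.const Unit μ) (η := κ) (a := ()) (f := φ)
  simp only [Kernel.comp_apply, Kernel.const_apply] at h
  exact h hφ

namespace ContMDP

/-! ### Laws of the Markov chain that follows a policy. -/

section StepDist

variable {S E : Type*} [MeasurableSpace S] [NormedAddCommGroup E] [NormedSpace ℝ E]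
  {M : ContMDP S E} {π : S → E}

theorem measurable_stepDist (hκ : Measurable fun s => M.τ (π s) s) (t : ℕ) :
    Measurable (M.stepDist π t) := by
  induction t with
  | zero => exact Measure.measurable_dirac
  | succ t ih => exact (Measure.measurable_bind' hκ).comp ih

/-- The transition kernel of the Markov chain that follows a deterministic policy. -/
noncomputable def policyKernel (hκ : Measurable fun s => M.τ (π s) s) : Kernel S S :=
  ⟨fun s => M.τ (π s) s, hκ⟩

/-- The `t`-step transition kernel of the Markov chain that follows a deterministic policy. -/
noncomputable def stepKernel (hκ : Measurable fun s => M.τ (π s) s) (t : ℕ) : Kernel S S :=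
  ⟨M.stepDist π t, measurable_stepDist hκ t⟩

theorem isMarkovKernel_policyKernel (hκ : Measurable fun s => M.τ (π s) s)
    (hA : ∀ s, π s ∈ M.A) : IsMarkovKernel (policyKernel hκ) :=
  ⟨fun s => (M.isMarkovKernel _ (hA s)).isProbabilityMeasure s⟩

theorem isMarkovKernel_stepKernel (hκ : Measurable fun s => M.τ (π s) s)
    (hA : ∀ s, π s ∈ M.A) (t : ℕ) : IsMarkovKernel (stepKernel hκ t) := by
  induction t with
  | zero => exact ⟨fun s => inferInstanceAs (IsProbabilityMeasure (Measure.dirac s))⟩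
  | succ t ih =>
    have := isMarkovKernel_policyKernel hκ hA
    exact ⟨fun s => inferInstanceAs
      (IsProbabilityMeasure ((stepKernel hκ t s).bind (policyKernel hκ)))⟩

theorem isFiniteMeasure_discountedStateDist (hκ : Measurable fun s => M.τ (π s) s)
    (hA : ∀ s, π s ∈ M.A) (ν : Measure S) (p₁ : S → ℝ)
    [IsProbabilityMeasure (ν.withDensity fun s => ENNReal.ofReal (p₁ s))] :
    IsFiniteMeasure (M.discountedStateDist ν p₁ π) := by
  refine ⟨?_⟩
  -- Each time step contributes a probability measure, so the total mass is the geometric series in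
  -- `γ`.
  have h1 (t : ℕ) : ((ν.withDensity fun s => ENNReal.ofReal (p₁ s)).bind (M.stepDist π t))
      Set.univ = 1 := by
    have := isMarkovKernel_stepKernel hκ hA t
    exact measure_univ (μ := (ν.withDensity fun s =>
      ENNReal.ofReal (p₁ s)).bind (stepKernel hκ t))
  rw [discountedStateDist, Measure.sum_apply _ MeasurableSet.univ]
  simp only [Measure.smul_apply, h1, smul_eq_mul, mul_one]
  rw [← ENNReal.ofReal_tsum_of_nonneg (fun t => pow_nonneg M.γ_pos.le t)
    (summable_geometric_of_lt_one M.γ_pos.le M.γ_lt_one)]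
  exact ENNReal.ofReal_lt_top

end StepDist

/-! ### The policy gradient theorem on a compact state space. -/

section Regular

variable {S E Θ : Type*} [TopologicalSpace S] [SecondCountableTopology S] [MeasurableSpace S]
  [BorelSpace S] [NormedAddCommGroup E] [NormedSpace ℝ E] [NormedAddCommGroup Θ]
  [NormedSpace ℝ Θ] {ν : Measure S} {M : ContMDP S E} {q : E → S → S → ℝ} {p₁ : S → ℝ} {b L : ℝ}
  {π : Θ → S → E}

omit [SecondCountableTopology S] [BorelSpace S] in
theorem IsRegular.continuous_density (hM : M.IsRegular ν q p₁ b L) (hπ : M.IsRegularPolicy π) :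
    Continuous fun x : Θ × S × S => q (π x.1 x.2.1) x.2.1 x.2.2 := by
  have := hπ.continuous
  exact hM.q_continuous.comp_continuous (f := fun x : Θ × S × S => (π x.1 x.2.1, x.2.1, x.2.2))
    (by fun_prop) fun x => ⟨hπ.mem_A _ _, trivial⟩

theorem IsRegular.measurable_transition [SFinite ν] (hM : M.IsRegular ν q p₁ b L)
    (hπ : M.IsRegularPolicy π) (θ : Θ) : Measurable fun s => M.τ (π θ s) s := by
  refine Measure.measurable_of_measurable_coe _ fun B hB => ?_
  have hq : Measurable fun x : S × S => q (π θ x.1) x.1 x.2 :=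
    ((hM.continuous_density hπ).comp (by fun_prop : Continuous fun x : S × S => (θ, x))).measurable
  simp only [hM.τ_eq _ (hπ.mem_A θ _), withDensity_apply _ hB]
  exact Measurable.lintegral_prod_right' (f := fun x : S × S =>
    ENNReal.ofReal (q (π θ x.1) x.1 x.2)) hq.ennreal_ofReal

omit [SecondCountableTopology S] [BorelSpace S] in
theorem IsRegular.isProbabilityMeasure_initial (hM : M.IsRegular ν q p₁ b L) :
    IsProbabilityMeasure (ν.withDensity fun s => ENNReal.ofReal (p₁ s)) :=
  ⟨by rw [withDensity_apply _ MeasurableSet.univ, Measure.restrict_univ, hM.p₁_total]⟩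

-- Absorbing the density into the measure makes the performance an integral that can be transported
-- along `f`.
omit [SecondCountableTopology S] in
theorem IsRegular.performance_eq (hM : M.IsRegular ν q p₁ b L) (π : S → E) :
    M.performance ν p₁ π
      = ∫ s, M.value π s ∂(ν.withDensity fun s => ENNReal.ofReal (p₁ s)) := by
  rw [integral_withDensity_eq_integral_toReal_smul hM.p₁_continuous.measurable.ennreal_ofReal
    (ae_of_all _ fun _ => ENNReal.ofReal_lt_top)]
  simp only [ENNReal.toReal_ofReal (hM.p₁_nonneg _), smul_eq_mul, performance]

omit [SecondCountableTopology S] in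
theorem IsRegular.integral_transition (hM : M.IsRegular ν q p₁ b L) {a : E} (ha : a ∈ M.A)
    (s : S) (φ : S → ℝ) : ∫ y, φ y ∂(M.τ a s) = ∫ y, q a s y * φ y ∂ν := by
  have hq : Continuous fun y => q a s y :=
    hM.q_continuous.comp_continuous (f := fun y : S => (a, s, y)) (by fun_prop)
      fun y => ⟨ha, trivial⟩
  rw [hM.τ_eq a ha s, integral_withDensity_eq_integral_toReal_smul hq.measurable.ennreal_ofReal
    (ae_of_all _ fun _ => ENNReal.ofReal_lt_top)]
  simp only [ENNReal.toReal_ofReal (hM.q_nonneg a ha s _), smul_eq_mul]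

variable [CompactSpace S] [IsFiniteMeasure ν]

/-- The transition density of the Markov chain that follows a policy, as a continuous function. -/
noncomputable def IsRegular.density (hM : M.IsRegular ν q p₁ b L) (hπ : M.IsRegularPolicy π)
    (θ : Θ) : C(S × S, ℝ) where
  toFun x := q (π θ x.1) x.1 x.2
  continuous_toFun :=
    (hM.continuous_density hπ).comp (by fun_prop : Continuous fun x : S × S => (θ, x))

/-- The derivative of the transition density in the policy parameter. -/
noncomputable def IsRegular.densityDeriv (hM : M.IsRegular ν q p₁ b L)
    (hπ : M.IsRegularPolicy π) : C(Θ × (S × S), Θ →L[ℝ] ℝ) where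
  toFun x := (fderiv ℝ (fun a => q a x.2.1 x.2.2) (π x.1 x.2.1)).comp
    (fderiv ℝ (fun ϑ => π ϑ x.2.1) x.1)
  continuous_toFun := by
    have := hπ.continuous
    refine Continuous.clm_comp ?_ ?_
    · exact hM.q_gradient_continuous.comp_continuous
        (f := fun x : Θ × S × S => (π x.1 x.2.1, x.2.1, x.2.2)) (by fun_prop)
        fun x => ⟨hπ.mem_A _ _, trivial⟩
    · exact hπ.gradient_continuous.comp
        (by fun_prop : Continuous fun x : Θ × S × S => (x.1, x.2.1))

/-- The reward collected by a policy, as a continuous function. -/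
noncomputable def IsRegular.reward (hM : M.IsRegular ν q p₁ b L) (hπ : M.IsRegularPolicy π)
    (θ : Θ) : C(S, ℝ) where
  toFun s := M.R s (π θ s)
  continuous_toFun := by
    have := hπ.continuous
    exact hM.R_continuous.comp_continuous (f := fun s : S => (s, π θ s)) (by fun_prop)
      fun x => ⟨trivial, hπ.mem_A _ _⟩

/-- The derivative of the reward collected by a policy in the policy parameter. -/
noncomputable def IsRegular.rewardDeriv (hM : M.IsRegular ν q p₁ b L)
    (hπ : M.IsRegularPolicy π) : C(Θ × S, Θ →L[ℝ] ℝ) where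
  toFun x := (fderiv ℝ (M.R x.2) (π x.1 x.2)).comp (fderiv ℝ (fun ϑ => π ϑ x.2) x.1)
  continuous_toFun := by
    have := hπ.continuous
    refine Continuous.clm_comp ?_ hπ.gradient_continuous
    exact hM.R_gradient_continuous.comp_continuous
      (f := fun x : Θ × S => (x.2, π x.1 x.2)) (by fun_prop) fun x => ⟨trivial, hπ.mem_A _ _⟩

omit [SecondCountableTopology S] [BorelSpace S] [IsFiniteMeasure ν] in
theorem IsRegular.hasFDerivAt_density (hM : M.IsRegular ν q p₁ b L)
    (hπ : M.IsRegularPolicy π) (θ : Θ) :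
    HasFDerivAt (hM.density hπ) (ContinuousMap.flipCLM ((hM.densityDeriv hπ).curry θ)) θ :=
  ContinuousMap.hasFDerivAt_of_forall_hasFDerivAt _ _ (fun θ x =>
    (hM.q_differentiable _ (hπ.mem_A θ x.1) x.1 x.2).hasFDerivAt.comp θ
      (hπ.differentiable x.1 θ).hasFDerivAt) θ

omit [SecondCountableTopology S] [BorelSpace S] [IsFiniteMeasure ν] in
theorem IsRegular.hasFDerivAt_reward (hM : M.IsRegular ν q p₁ b L)
    (hπ : M.IsRegularPolicy π) (θ : Θ) :
    HasFDerivAt (hM.reward hπ) (ContinuousMap.flipCLM ((hM.rewardDeriv hπ).curry θ)) θ :=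
  ContinuousMap.hasFDerivAt_of_forall_hasFDerivAt _ _ (fun θ s =>
    (hM.R_differentiable s _ (hπ.mem_A θ s)).hasFDerivAt.comp θ
      (hπ.differentiable s θ).hasFDerivAt) θ

/-- The transition operator of the Markov chain that follows a policy. -/
noncomputable def IsRegular.transitionOp (hM : M.IsRegular ν q p₁ b L)
    (hπ : M.IsRegularPolicy π) (θ : Θ) : C(S, ℝ) →L[ℝ] C(S, ℝ) :=
  kernelOperator ν (hM.density hπ θ)

theorem IsRegular.transitionOp_apply (hM : M.IsRegular ν q p₁ b L)
    (hπ : M.IsRegularPolicy π) (θ : Θ) (φ : C(S, ℝ)) (s : S) :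
    hM.transitionOp hπ θ φ s = ∫ y, φ y ∂(M.τ (π θ s) s) :=
  (hM.integral_transition (hπ.mem_A θ s) s φ).symm

/-- Averaging against a probability measure does not increase the sup norm. -/
theorem IsRegular.norm_transitionOp_le (hM : M.IsRegular ν q p₁ b L)
    (hπ : M.IsRegularPolicy π) (θ : Θ) : ‖hM.transitionOp hπ θ‖ ≤ 1 := by
  refine ContinuousLinearMap.opNorm_le_bound _ zero_le_one fun φ => ?_
  refine (ContinuousMap.norm_le _ (by positivity)).2 fun s => ?_
  have := (M.isMarkovKernel _ (hπ.mem_A θ s)).isProbabilityMeasure s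
  rw [hM.transitionOp_apply hπ, one_mul]
  simpa using norm_integral_le_of_norm_le_const (μ := M.τ (π θ s) s)
    (ae_of_all _ φ.norm_coe_le_norm)

theorem IsRegular.transitionOp_pow_apply (hM : M.IsRegular ν q p₁ b L)
    (hπ : M.IsRegularPolicy π) (θ : Θ) (t : ℕ) (φ : C(S, ℝ)) (s : S) :
    (hM.transitionOp hπ θ ^ t) φ s = ∫ y, φ y ∂(M.stepDist (π θ) t s) := by
  have hκ := hM.measurable_transition hπ θ
  have := isMarkovKernel_policyKernel hκ (hπ.mem_A θ)
  induction t generalizing φ with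
  | zero =>
    simp only [pow_zero, stepDist]
    exact (integral_dirac' φ s φ.continuous.stronglyMeasurable).symm
  | succ t ih =>
    have := isMarkovKernel_stepKernel hκ (hπ.mem_A θ) t
    -- The last step of the chain is split off, matching `K ^ (t + 1) = K ^ t * K`.
    have h := Kernel.integral_comp_measure (μ := stepKernel hκ t s) (κ := policyKernel hκ)
      (φ.integrable_of_compactSpace _)
    rw [pow_succ, mul_apply_eq_comp, ih]
    simp only [hM.transitionOp_apply]
    exact h.symm

/-- Evaluated at `s`, the Neumann series of the resolvent is the discounted sum of expected rewards.
-/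
theorem IsRegular.value_eq (hM : M.IsRegular ν q p₁ b L)
    (hπ : M.IsRegularPolicy π) (θ : Θ) (s : S) :
    M.value (π θ) s
      = Ring.inverse (1 - M.γ • hM.transitionOp hπ θ) (hM.reward hπ θ) s := by
  have h := (hasSum_inverse_one_sub_smul (hM.norm_transitionOp_le hπ θ) M.γ_pos M.γ_lt_one
    (hM.reward hπ θ)).mapL (ContinuousMap.evalCLM ℝ s)
  refine Eq.trans ?_ h.tsum_eq
  refine tsum_congr fun t => ?_
  rw [map_smul, ContinuousMap.evalCLM_apply, hM.transitionOp_pow_apply hπ]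
  rfl

/-- Duality: `ρ` is the image of the initial law under the adjoint of the resolvent. Both sides are
sums of the same series over time. -/
theorem IsRegular.integral_discountedStateDist (hM : M.IsRegular ν q p₁ b L)
    (hπ : M.IsRegularPolicy π) (θ : Θ) (φ : C(S, ℝ)) :
    ∫ s, φ s ∂(M.discountedStateDist ν p₁ (π θ))
      = ∫ s, Ring.inverse (1 - M.γ • hM.transitionOp hπ θ) φ s
          ∂(ν.withDensity fun s => ENNReal.ofReal (p₁ s)) := by
  have hκ := hM.measurable_transition hπ θ
  have := hM.isProbabilityMeasure_initial
  have := isFiniteMeasure_discountedStateDist hκ (hπ.mem_A θ) ν p₁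
  set μ := ν.withDensity fun s => ENNReal.ofReal (p₁ s)
  have h := (hasSum_inverse_one_sub_smul (hM.norm_transitionOp_le hπ θ) M.γ_pos M.γ_lt_one
    φ).mapL (integralCLM μ)
  have h' := hasSum_integral_measure
    (φ.integrable_of_compactSpace (M.discountedStateDist ν p₁ (π θ)))
  refine h'.unique ?_
  refine Eq.mp ?_ h
  congr 1
  funext t
  have := isMarkovKernel_stepKernel hκ (hπ.mem_A θ) t
  have ht := Kernel.integral_comp_measure (μ := μ) (κ := stepKernel hκ t)
      (φ.integrable_of_compactSpace _)
  rw [integral_smul_measure, ENNReal.toReal_ofReal (pow_nonneg M.γ_pos.le t), map_smul,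
    integralCLM_apply]
  simp only [hM.transitionOp_pow_apply]
  exact congrArg _ ht.symm

/-- The derivative of the action-value function in the action. -/
theorem IsRegular.hasFDerivAt_actionValue (hM : M.IsRegular ν q p₁ b L)
    {π : S → E} (s : S) {a : E} (ha : a ∈ M.A) (φ : C(S, ℝ)) (hφ : ∀ s, M.value π s = φ s) :
    Integrable (fun y => φ y • fderiv ℝ (fun x => q x s y) a) ν ∧
    HasFDerivAt (M.actionValue π s)
      (fderiv ℝ (M.R s) a + M.γ • ∫ y, φ y • fderiv ℝ (fun x => q x s y) a ∂ν) a := by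
  have hA : M.A ∈ 𝓝 a := M.isOpen_A.mem_nhds ha
  have hq : ∀ x ∈ M.A, Continuous fun y => q x s y := fun x hx =>
    hM.q_continuous.comp_continuous (f := fun y : S => (x, s, y)) (by fun_prop)
      fun y => ⟨hx, trivial⟩
  have hq' : Continuous fun y => fderiv ℝ (fun x => q x s y) a :=
    hM.q_gradient_continuous.comp_continuous (f := fun y : S => (a, s, y)) (by fun_prop)
      fun y => ⟨ha, trivial⟩
  -- A constant dominates because `ν` is finite; `φ`, the value function of the fixed policy, does
  -- not vary with the action.
  have hbd : ∀ y, ∀ x ∈ M.A, ‖φ y • fderiv ℝ (fun x => q x s y) x‖ ≤ ‖φ‖ * L := fun y x hx => by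
    rw [norm_smul]
    exact mul_le_mul (φ.norm_coe_le_norm y) (hM.q_gradient_lt x hx s y).le (norm_nonneg _)
      (norm_nonneg _)
  have hmeas : AEStronglyMeasurable (fun y => φ y • fderiv ℝ (fun x => q x s y) a) ν :=
    (φ.continuous.smul hq').aestronglyMeasurable
  refine ⟨Integrable.of_bound hmeas (‖φ‖ * L) (ae_of_all _ fun y => hbd y a ha), ?_⟩
  have hint : HasFDerivAt (fun x => ∫ y, q x s y * φ y ∂ν)
      (∫ y, φ y • fderiv ℝ (fun x => q x s y) a ∂ν) a := by
    refine hasFDerivAt_integral_of_dominated_of_fderiv_le (bound := fun _ => ‖φ‖ * L)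
      (F' := fun x y => φ y • fderiv ℝ (fun x => q x s y) x) hA ?_ ?_ hmeas
      (ae_of_all _ hbd) (integrable_const _)
      (ae_of_all _ fun y x hx => (hM.q_differentiable x hx s y).hasFDerivAt.mul_const _)
    · filter_upwards [hA] with x hx
      exact ((hq x hx).mul φ.continuous).aestronglyMeasurable
    · exact ContinuousMap.integrable_of_compactSpace ν ⟨_, (hq a ha).mul φ.continuous⟩
  refine ((hM.R_differentiable s a ha).hasFDerivAt.add (hint.const_smul M.γ)).congr_of_eventuallyEq
    ?_
  filter_upwards [hA] with x hx
  simp only [actionValue, hφ, hM.integral_transition hx, Pi.add_apply, Pi.smul_apply, smul_eq_mul]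

/-- The **deterministic policy gradient theorem** on a compact state space. -/
theorem IsRegular.policy_gradient [FiniteDimensional ℝ Θ] (hM : M.IsRegular ν q p₁ b L)
    (hπ : M.IsRegularPolicy π) (θ : Θ) :
    (∀ s, DifferentiableAt ℝ (M.actionValue (π θ) s) (π θ s)) ∧
    Integrable (fun s => (fderiv ℝ (M.actionValue (π θ) s) (π θ s)).comp
      (fderiv ℝ (fun ϑ => π ϑ s) θ)) (M.discountedStateDist ν p₁ (π θ)) ∧
    HasFDerivAt (fun ϑ => M.performance ν p₁ (π ϑ))
      (∫ s, (fderiv ℝ (M.actionValue (π θ) s) (π θ s)).comp (fderiv ℝ (fun ϑ => π ϑ s) θ)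
        ∂(M.discountedStateDist ν p₁ (π θ))) θ := by
  have := hM.isProbabilityMeasure_initial
  have := isFiniteMeasure_discountedStateDist (hM.measurable_transition hπ θ) (hπ.mem_A θ) ν p₁
  set V := Ring.inverse (1 - M.γ • hM.transitionOp hπ θ) (hM.reward hπ θ) with hV
  have hQ := fun s => hM.hasFDerivAt_actionValue s (hπ.mem_A θ s) V (hM.value_eq hπ θ)
  -- The operator is a continuous linear function of its kernel, so sup-norm differentiability of
  -- the density passes to the operator norm.
  have hK : HasFDerivAt (hM.transitionOp hπ) ((kernelOperator ν).comp
      (ContinuousMap.flipCLM ((hM.densityDeriv hπ).curry θ))) θ :=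
    HasFDerivAt.comp (g := kernelOperator ν) θ (kernelOperator ν).hasFDerivAt
      (hM.hasFDerivAt_density hπ θ)
  set W : Θ →L[ℝ] C(S, ℝ) := ContinuousMap.flipCLM ((hM.rewardDeriv hπ).curry θ) + M.γ •
    ((kernelOperator ν).comp (ContinuousMap.flipCLM ((hM.densityDeriv hπ).curry θ))).flip V
    with hW
  have hJ : HasFDerivAt (fun ϑ => M.performance ν p₁ (π ϑ))
      ((integralCLM (ν.withDensity fun s => ENNReal.ofReal (p₁ s))).comp
        ((Ring.inverse (1 - M.γ • hM.transitionOp hπ θ)).comp W)) θ := by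
    have h := (integralCLM (ν.withDensity fun s => ENNReal.ofReal (p₁ s))).hasFDerivAt.comp θ
      (hasFDerivAt_inverse_one_sub_smul_apply M.γ_pos M.γ_lt_one (hM.norm_transitionOp_le hπ) hK
        (hM.hasFDerivAt_reward hπ θ))
    refine h.congr_of_eventuallyEq (Eventually.of_forall fun ϑ => ?_)
    simp only [hM.performance_eq, hM.value_eq hπ, Function.comp_apply, integralCLM_apply]
  -- The crux: `W`, the bracket of the resolvent formula, is the chain rule product of the theorem.
  have hgrad : ∀ s h, (fderiv ℝ (M.actionValue (π θ) s) (π θ s)).comp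
      (fderiv ℝ (fun ϑ => π ϑ s) θ) h = W h s := fun s h => by
    rw [(hQ s).2.fderiv]
    simp only [hW, ContinuousLinearMap.comp_apply, add_apply, smul_apply, ContinuousLinearMap.integral_apply (hQ s).1,
      ContinuousLinearMap.flip_apply, ContinuousMap.add_apply, ContinuousMap.smul_apply,
      kernelOperator_apply, ContinuousMap.flipCLM_apply, ContinuousMap.curry_apply,
      IsRegular.rewardDeriv, IsRegular.densityDeriv, ContinuousMap.coe_mk, smul_eq_mul,
      mul_comm (V _)]
  -- Continuity is checked one direction `h` at a time, where it holds because `W h` lies in `C(S,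
  -- ℝ)`; this suffices as `Θ` is finite-dimensional.
  have hcont : Continuous fun s => (fderiv ℝ (M.actionValue (π θ) s) (π θ s)).comp
      (fderiv ℝ (fun ϑ => π ϑ s) θ) :=
    continuous_clm_apply.2 fun h => by simpa only [hgrad] using (W h).continuous
  have hint : Integrable (fun s => (fderiv ℝ (M.actionValue (π θ) s) (π θ s)).comp
      (fderiv ℝ (fun ϑ => π ϑ s) θ)) (M.discountedStateDist ν p₁ (π θ)) :=
    ContinuousMap.integrable_of_compactSpace _ ⟨_, hcont⟩
  refine ⟨fun s => (hQ s).2.differentiableAt, hint, hJ.congr_fderiv ?_⟩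
  ext h
  rw [ContinuousLinearMap.integral_apply hint]
  simp only [hgrad, hM.integral_discountedStateDist hπ]
  rfl

end Regular

/-! ### Transfer along a homomorphism. -/

section Hom

variable {S E S' E' : Type*} [MeasurableSpace S] [NormedAddCommGroup E] [NormedSpace ℝ E]
  [MeasurableSpace S'] [NormedAddCommGroup E'] [NormedSpace ℝ E']
  [MeasurableSpace E] [MeasurableSpace E']
  {M : ContMDP S E} {M' : ContMDP S' E'} {f : S → S'} {g : S → E → E'} {π : S → E} {π' : S' → E'}

/-- A homomorphism maps the state distributions of a lifted policy to those of the policy. -/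
theorem IsHom.map_stepDist (hom : M.IsHom M' f g) (hA : ∀ s, π s ∈ M.A)
    (hlift : IsLift f g π π') (hκ : Measurable fun s => M.τ (π s) s)
    (hκ' : Measurable fun s => M'.τ (π' s) s) (t : ℕ) (s : S) :
    (M.stepDist π t s).map f = M'.stepDist π' t (f s) := by
  induction t with
  | zero => exact Measure.map_dirac' hom.f_measurable s
  | succ t ih =>
    ext B hB
    have hB' := hom.f_measurable hB
    simp only [stepDist]
    rw [Measure.map_apply hom.f_measurable hB, Measure.bind_apply hB' hκ.aemeasurable,
      Measure.bind_apply hB hκ'.aemeasurable, ← ih,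
      lintegral_map (f := fun s => M'.τ (π' s) s B) ((Measure.measurable_coe hB).comp hκ')
        hom.f_measurable]
    -- Only the action chosen by the lift matters, and `g s` sends it to `π' (f s)`.
    refine lintegral_congr fun s => ?_
    rw [← hlift s, hom.transition s _ (hA s) B hB]

/-- Value equivalence: a lifted policy and the policy have the same value function. -/
theorem IsHom.value_eq (hom : M.IsHom M' f g) (hA : ∀ s, π s ∈ M.A)
    (hlift : IsLift f g π π') (hκ : Measurable fun s => M.τ (π s) s)
    (hκ' : Measurable fun s => M'.τ (π' s) s) (hR : StronglyMeasurable fun s => M'.R s (π' s))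
    (s : S) : M.value π s = M'.value π' (f s) := by
  -- The series agree term by term, so no convergence is needed.
  refine tsum_congr fun t => ?_
  rw [hom.γ_eq, ← hom.map_stepDist hA hlift hκ hκ',
    integral_map hom.f_measurable.aemeasurable hR.aestronglyMeasurable]
  simp only [← hlift _, hom.reward _ _ (hA _)]

end Hom

end ContMDP

/-! ### The homomorphic policy gradient theorem. -/

theorem mainTheorem5
    {S S' : Type*}
    [TopologicalSpace S] [SecondCountableTopology S] [MeasurableSpace S] [BorelSpace S]
    [TopologicalSpace S'] [SecondCountableTopology S'] [MeasurableSpace S'] [BorelSpace S']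
    [CompactSpace S']
    (ν : Measure S) [SigmaFinite ν] (ν' : Measure S') [IsFiniteMeasure ν']
    {n n' k : ℕ}
    (M : ContMDP S (EuclideanSpace ℝ (Fin n))) (M' : ContMDP S' (EuclideanSpace ℝ (Fin n')))
    (f : S → S') (g : S → EuclideanSpace ℝ (Fin n) → EuclideanSpace ℝ (Fin n'))
    (hom : M.IsHom M' f g)
    (q : EuclideanSpace ℝ (Fin n) → S → S → ℝ) (p₁ : S → ℝ)
    (q' : EuclideanSpace ℝ (Fin n') → S' → S' → ℝ) (p₁' : S' → ℝ)
    (b L : ℝ)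
    (hM : M.IsRegular ν q p₁ b L) (hM' : M'.IsRegular ν' q' p₁' b L)
    (hp₁ : (ν.withDensity (fun s => ENNReal.ofReal (p₁ s))).map f
      = ν'.withDensity (fun s' => ENNReal.ofReal (p₁' s')))
    (hg : M.IsRegularActionMap g L)
    (π' : EuclideanSpace ℝ (Fin k) → S' → EuclideanSpace ℝ (Fin n'))
    (hπ' : M'.IsRegularPolicy π')
    (πl : EuclideanSpace ℝ (Fin k) → S → EuclideanSpace ℝ (Fin n))
    (hπl : M.IsRegularPolicy πl)
    (hlift : ∀ θ, ContMDP.IsLift f g (πl θ) (π' θ))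
    (θ : EuclideanSpace ℝ (Fin k)) :
    (∀ s', DifferentiableAt ℝ (fun a' => M'.actionValue (π' θ) s' a') (π' θ s')) ∧
    Integrable
      (fun s' => (fderiv ℝ (fun a' => M'.actionValue (π' θ) s' a') (π' θ s')).comp
        (fderiv ℝ (fun ϑ => π' ϑ s') θ))
      (M'.discountedStateDist ν' p₁' (π' θ)) ∧
    HasFDerivAt (fun ϑ => M.performance ν p₁ (πl ϑ))
      (∫ s', (fderiv ℝ (fun a' => M'.actionValue (π' θ) s' a') (π' θ s')).comp
          (fderiv ℝ (fun ϑ => π' ϑ s') θ)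
        ∂(M'.discountedStateDist ν' p₁' (π' θ))) θ := by
  -- The equality holds for every parameter, so it can be differentiated; neither `f` nor `g` is
  -- differentiated.
  have hJ : (fun ϑ => M.performance ν p₁ (πl ϑ)) = fun ϑ => M'.performance ν' p₁' (π' ϑ) := by
    funext ϑ
    have hV : M'.value (π' ϑ) = _ := funext (hM'.value_eq hπ' ϑ)
    rw [hM.performance_eq, hM'.performance_eq, ← hp₁, integral_map
      hom.f_measurable.aemeasurable (hV ▸ (ContinuousMap.continuous _).aestronglyMeasurable)]
    exact integral_congr_ae (ae_of_all _ (hom.value_eq (hπl.mem_A ϑ) (hlift ϑ)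
      (hM.measurable_transition hπl ϑ) (hM'.measurable_transition hπ' ϑ)
      (hM'.reward hπ' ϑ).continuous.stronglyMeasurable))
  rw [hJ]
  exact hM'.policy_gradient hπ' θ
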